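/- For $A\in{\bf M}_3(\mathbb C)$ let $W(A)=\{\langle Ax,x\rangle : x\in\mathbb C^3,\ \|x\|=1\}$ be its numerical range. For real $\theta$ let $\lambda_1(\theta)\ge\lambda_2(\theta)\ge\lambda_3(\theta)$ be the eigenvalues, counted with multiplicity, of $\operatorname{Re}(e^{i\theta}A)$, where $\operatorname{Re}X=\frac{X+X^*}{2}$. Call $A$ generic if $\lambda_1(\theta),\lambda_2(\theta),\lambda_3(\theta)$ are distinct for every $\theta$. An ellipse means here a non-degenerate elliptical disk (circular disks included), that is, the image of the closed unit disk under an invertible real affine map of the plane. A set $K\subset\mathbb C$ has an ovular shape if it is a compact, strictly convex set (its boundary contains no line segment) with non-empty interior, has exactly one supporting line through each of its boundary points (no corners), and is not an ellipse. Then $A$ is generic if and only if $W(A)$ either (i) has an ovular shape, or (ii) is an ellipse with no eigenvalue of $A$ lying on its boundary. -/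

import Mathlib

namespace KippenhahnGeneric

/-- The numerical range `W(A) = {⟨Ax, x⟩ : ‖x‖ = 1}`. The scalar product of the source is linear in
its first argument and Mathlib's `inner ℂ` is linear in its second one, so `⟨Ax, x⟩` is
`inner ℂ x (A x)`. -/
def numericalRange {n : ℕ} (A : Matrix (Fin n) (Fin n) ℂ) : Set ℂ :=
  {w | ∃ x : EuclideanSpace ℂ (Fin n), ‖x‖ = 1 ∧ inner ℂ x (Matrix.toEuclideanLin A x) = w}

/-- `Re X = (X + X*) / 2`. -/
noncomputable def rePart {n : ℕ} (X : Matrix (Fin n) (Fin n) ℂ) : Matrix (Fin n) (Fin n) ℂ :=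
  (1 / 2 : ℂ) • (X + X.conjTranspose)

theorem rePart_isHermitian {n : ℕ} (X : Matrix (Fin n) (Fin n) ℂ) : (rePart X).IsHermitian := by
  simp [rePart, Matrix.IsHermitian, Matrix.conjTranspose_smul, add_comm]

/-- The `k`-th largest eigenvalue (counting multiplicities; `k` starts at `0`) of
`Re (e^{iθ} A)`. Mathlib lists `eigenvalues₀` in decreasing order. -/
noncomputable def kthEigenvalue {n : ℕ} (A : Matrix (Fin n) (Fin n) ℂ) (k : Fin n) (θ : ℝ) : ℝ :=
  (rePart_isHermitian (Complex.exp (θ * Complex.I) • A)).eigenvalues₀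
    (Fin.cast (Fintype.card_fin n).symm k)

/-- `A` is generic if the eigenvalues `λ₁(θ), …, λₙ(θ)` of `Re (e^{iθ} A)` are distinct for
every `θ`. -/
def IsGeneric {n : ℕ} (A : Matrix (Fin n) (Fin n) ℂ) : Prop :=
  ∀ θ : ℝ, Function.Injective fun k : Fin n => kthEigenvalue A k θ

/-- A (non-degenerate, filled) ellipse in the plane: the image of the closed unit disk under an
invertible real affine map. Circular disks are included. -/
def IsEllipse (K : Set ℂ) : Prop :=
  ∃ f : ℂ ≃ᵃ[ℝ] ℂ, K = f '' Metric.closedBall (0 : ℂ) 1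

/-- `u` is a unit outward normal of a supporting line of `K` through `z`. -/
def IsSupportNormal (K : Set ℂ) (z u : ℂ) : Prop :=
  ‖u‖ = 1 ∧ ∀ w ∈ K, (starRingEnd ℂ u * w).re ≤ (starRingEnd ℂ u * z).re

/-- `K` has an ovular shape: it is a compact convex set with non-empty interior whose boundary
contains no flat portions (`StrictConvex`) and no corners (there is only one supporting line through
every boundary point), and it is not an ellipse, the elliptical shape being a separate case
in Kippenhahn's classification. -/
structure IsOvular (K : Set ℂ) : Prop where
  isCompact : IsCompact K
  interior_nonempty : (interior K).Nonempty
  no_flat_portion : StrictConvex ℝ K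
  no_corner : ∀ z ∈ frontier K, ∃! u : ℂ, IsSupportNormal K z u
  not_ellipse : ¬ IsEllipse K

end KippenhahnGeneric

/-! The bridge is that `λ₁(θ)` is the maximum of `Re (e^{iθ} w)` over `w ∈ W(A)`, attained at the
values of the top eigenvectors of `Re (e^{iθ} A)`.

Let `A` be generic. The top eigenvector is unique up to phase, so each supporting line meets `W(A)`
in one point: strict convexity (`IsGeneric.strictConvex`). At a corner, the same `x` is an
eigenvector of two independent combinations of `A` and `A*`, and at an eigenvalue on the boundary
`Ax = μx` supplies the second equation; either way `x` is a common eigenvector of `A` and `A*`, with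
value `z` say. Then `Re (e^{iθ} z)` is an eigenvalue for all `θ`. Since the `λₖ` are continuous and
never meet, it stays on one branch, yet it is `λ₁` at some `θ` and `λ₃` at `θ + π`
(`IsGeneric.not_reducing`).

Conversely, suppose `λ₁ = λ₂` at some angle (the case `λ₂ = λ₃` follows by a half turn). Strict
convexity forces the compression of `A` to the double eigenspace to be a scalar `z`. This makes
`W(A)` computable: it is an ellipse, and `z` is an eigenvalue on its boundary
(`isEllipse_of_double_eigenvalue`), which both (i) and (ii) exclude. -/

namespace KippenhahnGeneric

open Matrix ComplexConjugate

/-! ### Eigenvalues of `Re (e^{iθ} A)` and the numerical range -/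

section Spectral

variable {n : ℕ} (A : Matrix (Fin n) (Fin n) ℂ)

theorem toEuclideanLin_rePart_apply (c : ℂ) (x : EuclideanSpace ℂ (Fin n)) :
    toEuclideanLin (rePart (c • A)) x =
      (1 / 2 : ℂ) • (c • toEuclideanLin A x + conj c • (toEuclideanLin A).adjoint x) := by
  rw [← toEuclideanLin_conjTranspose_eq_adjoint]
  simp [rePart, conjTranspose_smul]

theorem inner_rePart (c : ℂ) (x : EuclideanSpace ℂ (Fin n)) :
    inner ℂ x (toEuclideanLin (rePart (c • A)) x) =
      ((c * inner ℂ x (toEuclideanLin A x)).re : ℂ) := by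
  rw [toEuclideanLin_rePart_apply, inner_smul_right, inner_add_right, inner_smul_right,
    inner_smul_right, LinearMap.adjoint_inner_right, ← inner_conj_symm (toEuclideanLin A x) x,
    Complex.re_eq_add_conj, map_mul]
  ring

theorem rePart_isSymmetric (X : Matrix (Fin n) (Fin n) ℂ) :
    (toEuclideanLin (rePart X)).IsSymmetric :=
  isSymmetric_toEuclideanLin_iff.mpr (rePart_isHermitian X)

theorem kthEigenvalue_antitone (θ : ℝ) : Antitone fun k => kthEigenvalue A k θ := by
  intro i j hij
  exact (rePart_isHermitian (Complex.exp (θ * Complex.I) • A)).eigenvalues₀_antitone hij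

theorem exists_eigenbasis (θ : ℝ) :
    ∃ v : OrthonormalBasis (Fin n) ℂ (EuclideanSpace ℂ (Fin n)), ∀ k,
      toEuclideanLin (rePart (Complex.exp (θ * Complex.I) • A)) (v k) =
        (kthEigenvalue A k θ : ℂ) • v k := by
  refine ⟨((rePart_isSymmetric (Complex.exp (θ * Complex.I) • A)).eigenvectorBasis
    finrank_euclideanSpace).reindex (finCongr (Fintype.card_fin n)), fun k => ?_⟩
  rw [OrthonormalBasis.reindex_apply]
  exact (rePart_isSymmetric (Complex.exp (θ * Complex.I) • A)).apply_eigenvectorBasis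
    finrank_euclideanSpace _

/-- Gives continuity of the middle eigenvalue from that of the two extreme ones. -/
theorem sum_kthEigenvalue (θ : ℝ) :
    ∑ k, kthEigenvalue A k θ = (rePart (Complex.exp (θ * Complex.I) • A)).trace.re := by
  have h := (rePart_isHermitian (Complex.exp (θ * Complex.I) • A)).trace_eq_sum_eigenvalues
  rw [h, ← RCLike.ofReal_sum]
  change _ = Complex.re (Complex.ofReal _)
  rw [Complex.ofReal_re]
  refine Fintype.sum_equiv ((finCongr (Fintype.card_fin n).symm).trans
    (Fintype.equivOfCardEq (Fintype.card_fin _))) _ _ fun k => ?_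
  simp [IsHermitian.eigenvalues, kthEigenvalue]

/-- A symmetric operator diagonalized by `v` has the quadratic form `∑ lₖ |⟨vₖ, x⟩|²`. -/
theorem re_mul_inner_eq_sum (c : ℂ) (v : OrthonormalBasis (Fin n) ℂ (EuclideanSpace ℂ (Fin n)))
    (l : Fin n → ℝ)
    (hv : ∀ k, toEuclideanLin (rePart (c • A)) (v k) = (l k : ℂ) • v k)
    (x : EuclideanSpace ℂ (Fin n)) :
    (c * inner ℂ x (toEuclideanLin A x)).re = ∑ k, l k * ‖inner ℂ (v k) x‖ ^ 2 := by
  have h := inner_rePart A c x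
  rw [← v.sum_inner_mul_inner] at h
  have h2 : ∀ k, inner ℂ x (v k) * inner ℂ (v k) (toEuclideanLin (rePart (c • A)) x) =
      ((l k * ‖inner ℂ (v k) x‖ ^ 2 : ℝ) : ℂ) := by
    intro k
    rw [← rePart_isSymmetric, hv, inner_smul_left, ← inner_conj_symm x (v k), Complex.conj_ofReal,
      mul_left_comm, Complex.conj_mul']
    push_cast
    ring
  simp_rw [h2] at h
  rw [← Complex.ofReal_sum] at h
  exact (Complex.ofReal_injective h).symm

theorem sum_sq_norm_inner_eq_one (v : OrthonormalBasis (Fin n) ℂ (EuclideanSpace ℂ (Fin n)))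
    {x : EuclideanSpace ℂ (Fin n)} (hx : ‖x‖ = 1) : ∑ k, ‖inner ℂ (v k) x‖ ^ 2 = 1 := by
  rw [v.sum_sq_norm_inner_right, hx, one_pow]

theorem re_mul_inner_eigenvector (c : ℂ) {x : EuclideanSpace ℂ (Fin n)} (hx : ‖x‖ = 1) {l : ℝ}
    (h : toEuclideanLin (rePart (c • A)) x = (l : ℂ) • x) :
    (c * inner ℂ x (toEuclideanLin A x)).re = l := by
  have h1 := inner_rePart A c x
  rw [h, inner_smul_right, inner_self_eq_norm_sq_to_K, hx] at h1
  apply Complex.ofReal_injective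
  rw [← h1]; simp

theorem exists_mem_re_eq (k : Fin n) (θ : ℝ) :
    ∃ w ∈ numericalRange A, (Complex.exp (θ * Complex.I) * w).re = kthEigenvalue A k θ := by
  obtain ⟨v, hv⟩ := exists_eigenbasis A θ
  exact ⟨_, ⟨v k, v.norm_eq_one k, rfl⟩, re_mul_inner_eigenvector A _ (v.norm_eq_one k) (hv k)⟩

theorem re_le_of_mem {θ b : ℝ} (hb : ∀ k, kthEigenvalue A k θ ≤ b) {w : ℂ}
    (hw : w ∈ numericalRange A) : (Complex.exp (θ * Complex.I) * w).re ≤ b := by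
  obtain ⟨x, hx, rfl⟩ := hw
  obtain ⟨v, hv⟩ := exists_eigenbasis A θ
  rw [re_mul_inner_eq_sum A _ v _ hv, ← mul_one b, ← sum_sq_norm_inner_eq_one v hx, Finset.mul_sum]
  gcongr with k
  exact hb k

theorem le_re_of_mem {θ b : ℝ} (hb : ∀ k, b ≤ kthEigenvalue A k θ) {w : ℂ}
    (hw : w ∈ numericalRange A) : b ≤ (Complex.exp (θ * Complex.I) * w).re := by
  obtain ⟨x, hx, rfl⟩ := hw
  obtain ⟨v, hv⟩ := exists_eigenbasis A θ
  rw [re_mul_inner_eq_sum A _ v _ hv, ← mul_one b, ← sum_sq_norm_inner_eq_one v hx, Finset.mul_sum]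
  gcongr with k
  exact hb k

theorem isCompact_numericalRange : IsCompact (numericalRange A) := by
  have : numericalRange A =
      (fun x => inner ℂ x (toEuclideanLin A x)) '' Metric.sphere (0 : EuclideanSpace ℂ (Fin n)) 1 := by
    ext w; simp [numericalRange]
  rw [this]
  refine (isCompact_sphere _ _).image ?_
  exact continuous_id.inner (LinearMap.continuous_of_finiteDimensional _)

theorem exists_eq_kthEigenvalue {θ f : ℝ} {x : EuclideanSpace ℂ (Fin n)} (hx : x ≠ 0)
    (h : toEuclideanLin (rePart (Complex.exp (θ * Complex.I) • A)) x = (f : ℂ) • x) :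
    ∃ k, f = kthEigenvalue A k θ := by
  obtain ⟨v, hv⟩ := exists_eigenbasis A θ
  obtain ⟨k, hk⟩ : ∃ k, inner ℂ (v k) x ≠ 0 := by
    by_contra! hc
    exact hx (by rw [← v.sum_repr' x]; simp [hc])
  refine ⟨k, ?_⟩
  have h1 := rePart_isSymmetric (Complex.exp (θ * Complex.I) • A) (v k) x
  rw [hv, h, inner_smul_left, inner_smul_right, Complex.conj_ofReal] at h1
  exact (Complex.ofReal_injective (mul_right_cancel₀ hk h1)).symm

end Spectral

/-! ### Convexity of the numerical range -/

section ToeplitzHausdorff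

theorem exists_unit_mul_eq_norm (d : ℂ) : ∃ c : ℂ, ‖c‖ = 1 ∧ c * d = ‖d‖ := by
  by_cases hd : d = 0
  · exact ⟨1, by simp, by simp [hd]⟩
  · have hd' : (‖d‖ : ℂ) ≠ 0 := by simpa using hd
    refine ⟨conj d / ‖d‖, by simp [hd], ?_⟩
    rw [div_mul_eq_mul_div, Complex.conj_mul', sq, mul_div_assoc, div_self hd', mul_one]

/-- The **Toeplitz–Hausdorff theorem**. -/
theorem convex_numericalRange {n : ℕ} (A : Matrix (Fin n) (Fin n) ℂ) :
    Convex ℝ (numericalRange A) := by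
  rw [convex_iff_segment_subset]
  rintro a ⟨x, hx, rfl⟩ b ⟨y, hy, rfl⟩
  set T := toEuclideanLin A
  set a := inner ℂ x (T x) with ha
  set b := inner ℂ y (T y) with hb
  by_cases hab : a = b
  · rw [← hab, segment_same]
    rintro _ rfl
    exact ⟨x, hx, rfl⟩
  have hba : b - a ≠ 0 := sub_ne_zero.mpr (Ne.symm hab)
  -- Affine normalization of `T`: the values at `x` and `y` become `0` and `1`.
  set C : EuclideanSpace ℂ (Fin n) →ₗ[ℂ] EuclideanSpace ℂ (Fin n) :=
    (b - a)⁻¹ • (T - a • LinearMap.id) with hC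
  have hCv : ∀ v, inner ℂ v (C v) = (b - a)⁻¹ * (inner ℂ v (T v) - a * ‖v‖ ^ 2) := by
    intro v
    simp [hC, inner_self_eq_norm_sq_to_K]
  have hCx : inner ℂ x (C x) = 0 := by simp [hCv, hx, ← ha]
  have hCy : inner ℂ y (C y) = 1 := by simp [hCv, hy, ← hb, hba]
  -- This phase of `y` makes the cross term `g` real, so the form of `C` is real along the path `v`
  -- from `x` to `c • y`.
  obtain ⟨c, hc, hcd⟩ := exists_unit_mul_eq_norm (inner ℂ x (C y) - conj (inner ℂ y (C x)))
  have hcc : conj c * c = 1 := by rw [Complex.conj_mul', hc]; simp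
  set g : ℂ := c * inner ℂ x (C y) + conj c * inner ℂ y (C x) with hg
  have hgim : g.im = 0 := by
    have := congrArg Complex.im hcd
    simp only [Complex.ofReal_im, Complex.mul_im, Complex.sub_re, Complex.sub_im, Complex.conj_re,
      Complex.conj_im] at this
    simp only [hg, Complex.add_im, Complex.mul_im, Complex.conj_re, Complex.conj_im]
    linarith
  have hgre : g = (g.re : ℂ) := Complex.ext rfl (by simpa using hgim)
  set v : ℝ → EuclideanSpace ℂ (Fin n) := fun t => (1 - t : ℂ) • x + (t * c : ℂ) • y with hv
  have hCvt : ∀ t : ℝ, inner ℂ (v t) (C (v t)) = ((t ^ 2 + t * (1 - t) * g.re : ℝ) : ℂ) := by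
    intro t
    have : inner ℂ (v t) (C (v t)) = t ^ 2 * (conj c * c) + t * (1 - t) * g := by
      simp only [hv, map_add, map_smul, inner_add_left, inner_add_right, inner_smul_left,
        inner_smul_right, hCx, hCy, hg, map_sub, map_mul, map_one, Complex.conj_ofReal]
      ring
    rw [this, hcc, hgre]
    push_cast
    simp
  have hv0 : ∀ t, v t ≠ 0 := by
    intro t h0
    have h1 : (t * c : ℂ) • y = -((1 - t : ℂ) • x) := by
      rw [eq_neg_iff_add_eq_zero, add_comm]; exact h0
    have h2 : inner ℂ ((t * c : ℂ) • y) (C ((t * c : ℂ) • y)) = 0 := by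
      rw [h1]
      simp only [map_neg, map_smul, inner_neg_left, inner_neg_right, inner_smul_left,
        inner_smul_right, hCx]
      simp
    have ht : t = 0 := by
      simp only [map_smul, inner_smul_left, inner_smul_right, hCy, map_mul,
        Complex.conj_ofReal] at h2
      have : (t : ℂ) ^ 2 * (conj c * c) = 0 := by rw [← h2]; ring
      rw [hcc] at this
      simpa using this
    rw [hv] at h0
    simp only [ht] at h0
    simp only [Complex.ofReal_zero, sub_zero, one_smul, zero_mul, zero_smul, add_zero] at h0
    simp [h0] at hx
  have hcont : Continuous v := by rw [hv]; fun_prop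
  have hvn : ∀ t, ‖v t‖ ≠ 0 := fun t => norm_ne_zero_iff.mpr (hv0 t)
  -- The normalized value along the path is `0` at `t = 0` and `1` at `t = 1`; the intermediate
  -- value theorem fills the segment.
  have hhc : Continuous fun t : ℝ => (t ^ 2 + t * (1 - t) * g.re) / ‖v t‖ ^ 2 := by
    refine Continuous.div (by fun_prop) (by fun_prop) fun t => pow_ne_zero _ (hvn t)
  intro w hw
  rw [segment_eq_image] at hw
  obtain ⟨s, hs, rfl⟩ := hw
  have hivt := intermediate_value_Icc (zero_le_one (α := ℝ)) hhc.continuousOn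
  have hs' : s ∈ Set.Icc (((0:ℝ) ^ 2 + 0 * (1 - 0) * g.re) / ‖v 0‖ ^ 2)
      (((1:ℝ) ^ 2 + 1 * (1 - 1) * g.re) / ‖v 1‖ ^ 2) := by
    simpa [hv, norm_smul, hc, hy] using hs
  obtain ⟨t, -, ht⟩ := hivt hs'
  refine ⟨(‖v t‖⁻¹ : ℂ) • v t, by simp [norm_smul, hvn t], ?_⟩
  have hvc : (‖v t‖ : ℂ) ≠ 0 := by exact_mod_cast hvn t
  have h3 : inner ℂ (v t) (C (v t)) = (s : ℂ) * ‖v t‖ ^ 2 := by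
    rw [hCvt, ← ht]
    push_cast
    field_simp
  rw [hCv] at h3
  rw [map_smul, inner_smul_left, inner_smul_right]
  change _ * (_ * inner ℂ (v t) (T (v t))) = _
  have h4 : inner ℂ (v t) (T (v t)) = ((b - a) * s + a) * ‖v t‖ ^ 2 := by
    field_simp at h3
    linear_combination h3
  rw [h4]
  simp only [map_inv₀, Complex.conj_ofReal, Complex.real_smul]
  field_simp
  push_cast
  ring

end ToeplitzHausdorff

/-! ### Supporting lines of plane convex sets -/

section Plane

theorem exists_polar_of_functional {f : ℂ →ₗ[ℝ] ℝ} (hf : f ≠ 0) :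
    ∃ θ r : ℝ, 0 < r ∧ ∀ w, f w = r * (Complex.exp (θ * Complex.I) * w).re := by
  set p : ℂ := ⟨f 1, -f Complex.I⟩ with hp
  have hfp : ∀ w, f w = (p * w).re := by
    intro w
    have : w = w.re • (1 : ℂ) + w.im • Complex.I := by simp
    conv_lhs => rw [this]
    rw [map_add, map_smul, map_smul, Complex.mul_re]
    simp [hp]; ring
  have hp0 : p ≠ 0 := fun h => hf (LinearMap.ext fun w => by simp [hfp, h])
  refine ⟨p.arg, ‖p‖, by simpa using hp0, fun w => ?_⟩
  rw [hfp, ← Complex.re_ofReal_mul, ← mul_assoc, Complex.norm_mul_exp_arg_mul_I]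

theorem exists_angle_of_unit {c : ℂ} (hc : ‖c‖ = 1) : ∃ θ : ℝ, Complex.exp (θ * Complex.I) = c :=
  ⟨c.arg, by simpa [hc] using Complex.norm_mul_exp_arg_mul_I c⟩

theorem norm_exp_angle (θ : ℝ) : ‖Complex.exp (θ * Complex.I)‖ = 1 :=
  Complex.norm_exp_ofReal_mul_I θ

/-- A point of a convex body outside the interior lies on a supporting line. -/
theorem exists_angle_forall_le {K : Set ℂ} (hK : Convex ℝ K) (hi : (interior K).Nonempty) {z : ℂ}
    (hz : z ∉ interior K) :
    ∃ θ : ℝ, ∀ w ∈ K,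
      (Complex.exp (θ * Complex.I) * w).re ≤ (Complex.exp (θ * Complex.I) * z).re := by
  obtain ⟨f, hf, hle⟩ := geometric_hahn_banach_of_nonempty_interior_point hK hz hi
  obtain ⟨θ, r, hr, hfr⟩ := exists_polar_of_functional (f := (f : ℂ →ₗ[ℝ] ℝ))
    (fun h => hf (ContinuousLinearMap.coe_injective h))
  refine ⟨θ, fun w hw => ?_⟩
  have := hle w hw
  change (f : ℂ →ₗ[ℝ] ℝ) w ≤ (f : ℂ →ₗ[ℝ] ℝ) z at this
  rw [hfr, hfr] at this
  exact le_of_mul_le_mul_left this hr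

/-- A convex plane set without interior points lies on a line. -/
theorem exists_angle_re_const {K : Set ℂ} (hK : Convex ℝ K) (hne : K.Nonempty)
    (hi : ¬ (interior K).Nonempty) :
    ∃ θ b : ℝ, ∀ w ∈ K, (Complex.exp (θ * Complex.I) * w).re = b := by
  rw [hK.interior_nonempty_iff_affineSpan_eq_top] at hi
  obtain ⟨z, hz⟩ := hne
  have hzs : z ∈ affineSpan ℝ K := mem_affineSpan ℝ hz
  have hd : (affineSpan ℝ K).direction < ⊤ := by
    refine lt_top_iff_ne_top.mpr fun h => hi ?_
    exact (AffineSubspace.direction_eq_top_iff_of_nonempty ⟨z, hzs⟩).mp h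
  obtain ⟨f, hf, hle⟩ := Submodule.exists_le_ker_of_lt_top _ hd
  obtain ⟨θ, r, hr, hfr⟩ := exists_polar_of_functional hf
  refine ⟨θ, (Complex.exp (θ * Complex.I) * z).re, fun w hw => ?_⟩
  have h1 : f (w - z) = 0 := by
    have := hle (AffineSubspace.vsub_mem_direction (mem_affineSpan ℝ hw) hzs)
    simpa using this
  rw [map_sub, sub_eq_zero, hfr, hfr] at h1
  exact mul_left_cancel₀ hr.ne' h1

end Plane

/-! ### Continuity of the eigenvalues; geometry of `W(A)` for generic `A` -/

variable {A : Matrix (Fin 3) (Fin 3) ℂ}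

theorem kthEigenvalue_le_zero (k : Fin 3) (θ : ℝ) : kthEigenvalue A k θ ≤ kthEigenvalue A 0 θ :=
  kthEigenvalue_antitone A θ (Fin.zero_le k)

theorem kthEigenvalue_two_le (k : Fin 3) (θ : ℝ) : kthEigenvalue A 2 θ ≤ kthEigenvalue A k θ :=
  kthEigenvalue_antitone A θ (Fin.le_last k)

/-- A supremum over a compact set of a jointly continuous function is continuous in the parameter.
-/
theorem continuous_kthEigenvalue_zero : Continuous (kthEigenvalue A 0) := by
  have : kthEigenvalue A 0 = fun θ : ℝ =>
      sSup ((fun w : ℂ => (Complex.exp (θ * Complex.I) * w).re) '' numericalRange A) := by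
    funext θ
    refine (IsGreatest.csSup_eq ⟨?_, ?_⟩).symm
    · obtain ⟨w, hw, h⟩ := exists_mem_re_eq A 0 θ
      exact ⟨w, hw, h⟩
    · rintro _ ⟨w, hw, rfl⟩
      exact re_le_of_mem A (fun k => kthEigenvalue_le_zero k θ) hw
  rw [this]
  refine (isCompact_numericalRange A).continuous_sSup
    (f := fun (θ : ℝ) (w : ℂ) => (Complex.exp (θ * Complex.I) * w).re) ?_
  change Continuous fun p : ℝ × ℂ => (Complex.exp (p.1 * Complex.I) * p.2).re
  fun_prop

theorem continuous_kthEigenvalue_two : Continuous (kthEigenvalue A 2) := by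
  have : kthEigenvalue A 2 = fun θ : ℝ =>
      sInf ((fun w : ℂ => (Complex.exp (θ * Complex.I) * w).re) '' numericalRange A) := by
    funext θ
    refine (IsLeast.csInf_eq ⟨?_, ?_⟩).symm
    · obtain ⟨w, hw, h⟩ := exists_mem_re_eq A 2 θ
      exact ⟨w, hw, h⟩
    · rintro _ ⟨w, hw, rfl⟩
      exact le_re_of_mem A (fun k => kthEigenvalue_two_le k θ) hw
  rw [this]
  refine (isCompact_numericalRange A).continuous_sInf
    (f := fun (θ : ℝ) (w : ℂ) => (Complex.exp (θ * Complex.I) * w).re) ?_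
  change Continuous fun p : ℝ × ℂ => (Complex.exp (p.1 * Complex.I) * p.2).re
  fun_prop

theorem continuous_kthEigenvalue (k : Fin 3) : Continuous (kthEigenvalue A k) := by
  fin_cases k
  · exact continuous_kthEigenvalue_zero
  · have : kthEigenvalue A 1 = fun θ : ℝ => (rePart (Complex.exp (θ * Complex.I) • A)).trace.re -
        kthEigenvalue A 0 θ - kthEigenvalue A 2 θ := by
      funext θ
      rw [← sum_kthEigenvalue, Fin.sum_univ_three]
      ring
    change Continuous (kthEigenvalue A 1)
    rw [this]
    have hX : Continuous fun θ : ℝ => Complex.exp (θ * Complex.I) • A :=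
      (Complex.continuous_exp.comp (Complex.continuous_ofReal.mul continuous_const)).smul
        continuous_const
    have hR : Continuous fun θ : ℝ => rePart (Complex.exp (θ * Complex.I) • A) := by
      unfold rePart
      exact (Continuous.add hX hX.matrix_conjTranspose).const_smul (1 / 2 : ℂ)
    exact ((Complex.continuous_re.comp hR.matrix_trace).sub continuous_kthEigenvalue_zero).sub
      continuous_kthEigenvalue_two
  · exact continuous_kthEigenvalue_two

/-- A generic matrix has no reducing eigenvector with eigenvalue on a supporting line of its
numerical range. -/
theorem IsGeneric.not_reducing (hA : IsGeneric A) {x : EuclideanSpace ℂ (Fin 3)} (hx : x ≠ 0)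
    {z : ℂ} (hT : toEuclideanLin A x = z • x) (hT' : (toEuclideanLin A).adjoint x = conj z • x)
    {θ₁ : ℝ} (hz : (Complex.exp (θ₁ * Complex.I) * z).re = kthEigenvalue A 0 θ₁)
    (hz2 : kthEigenvalue A 2 (θ₁ + Real.pi) = (Complex.exp ((θ₁ + Real.pi : ℝ) * Complex.I) * z).re) :
    False := by
  set f : ℝ → ℝ := fun θ => (Complex.exp (θ * Complex.I) * z).re with hf
  have hfc : Continuous f := by rw [hf]; fun_prop
  -- The same vector `x` is an eigenvector of `Re (e^{iθ} A)` at every angle.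
  have hk : ∀ θ, ∃ k, f θ = kthEigenvalue A k θ := by
    intro θ
    refine exists_eq_kthEigenvalue A hx ?_
    rw [toEuclideanLin_rePart_apply, hT, hT', hf, Complex.re_eq_add_conj, map_mul]
    module
  set S : Set ℝ := {θ | f θ = kthEigenvalue A 0 θ} with hS
  have hclosed : ∀ k, IsClosed {θ | f θ = kthEigenvalue A k θ} := fun k =>
    isClosed_eq hfc (continuous_kthEigenvalue k)
  have hcompl : Sᶜ = {θ | f θ = kthEigenvalue A 1 θ} ∪ {θ | f θ = kthEigenvalue A 2 θ} := by
    ext θ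
    simp only [hS, Set.mem_compl_iff, Set.mem_ofPred_eq, Set.mem_union]
    constructor
    · intro h
      obtain ⟨k, hk⟩ := hk θ
      fin_cases k
      · exact absurd hk h
      · exact Or.inl hk
      · exact Or.inr hk
    · rintro (h | h) h0
      · exact absurd (hA θ (h0.symm.trans h)) (by decide)
      · exact absurd (hA θ (h0.symm.trans h)) (by decide)
  -- Genericity makes the three closed coincidence sets disjoint, so each is clopen in the connected
  -- line.
  have hclopen : IsClopen S := by
    refine ⟨hclosed 0, ?_⟩
    rw [← isClosed_compl_iff, hcompl]
    exact (hclosed 1).union (hclosed 2)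
  have h1 : θ₁ ∈ S := hz
  rcases isClopen_iff.mp hclopen with h | h
  · rw [h] at h1; exact h1
  · have h2 : θ₁ + Real.pi ∈ S := h ▸ Set.mem_univ _
    exact absurd (hA _ (hz2.trans h2)) (by decide)

/-- The form is an average of the eigenvalues with weights `|⟨vₖ, x⟩|²`; reaching the simple maximum
leaves no weight on the other two. -/
theorem IsGeneric.eq_smul_of_top (hA : IsGeneric A) {θ : ℝ}
    {v : OrthonormalBasis (Fin 3) ℂ (EuclideanSpace ℂ (Fin 3))}
    (hv : ∀ k, toEuclideanLin (rePart (Complex.exp (θ * Complex.I) • A)) (v k) =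
        (kthEigenvalue A k θ : ℂ) • v k)
    {x : EuclideanSpace ℂ (Fin 3)} (hx : ‖x‖ = 1)
    (htop : kthEigenvalue A 0 θ ≤
      (Complex.exp (θ * Complex.I) * inner ℂ x (toEuclideanLin A x)).re) :
    x = inner ℂ (v 0) x • v 0 := by
  rw [re_mul_inner_eq_sum A _ v _ hv, Fin.sum_univ_three] at htop
  have hn := sum_sq_norm_inner_eq_one v hx
  rw [Fin.sum_univ_three] at hn
  have h1 : kthEigenvalue A 1 θ < kthEigenvalue A 0 θ :=
    lt_of_le_of_ne (kthEigenvalue_le_zero 1 θ) fun h => absurd (hA θ h) (by decide)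
  have h2 : kthEigenvalue A 2 θ < kthEigenvalue A 0 θ :=
    lt_of_le_of_ne (kthEigenvalue_le_zero 2 θ) fun h => absurd (hA θ h) (by decide)
  have p1 := mul_nonneg (sub_nonneg.mpr h1.le) (sq_nonneg ‖inner ℂ (v 1) x‖)
  have p2 := mul_nonneg (sub_nonneg.mpr h2.le) (sq_nonneg ‖inner ℂ (v 2) x‖)
  have hsum : (kthEigenvalue A 0 θ - kthEigenvalue A 1 θ) * ‖inner ℂ (v 1) x‖ ^ 2 +
      (kthEigenvalue A 0 θ - kthEigenvalue A 2 θ) * ‖inner ℂ (v 2) x‖ ^ 2 ≤ 0 := by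
    have : kthEigenvalue A 0 θ * (‖inner ℂ (v 0) x‖ ^ 2 + ‖inner ℂ (v 1) x‖ ^ 2 +
        ‖inner ℂ (v 2) x‖ ^ 2) = kthEigenvalue A 0 θ := by rw [hn, mul_one]
    linarith
  have q1 : inner ℂ (v 1) x = 0 := by
    have : (kthEigenvalue A 0 θ - kthEigenvalue A 1 θ) * ‖inner ℂ (v 1) x‖ ^ 2 = 0 := by linarith
    simpa [(sub_pos.mpr h1).ne'] using this
  have q2 : inner ℂ (v 2) x = 0 := by
    have : (kthEigenvalue A 0 θ - kthEigenvalue A 2 θ) * ‖inner ℂ (v 2) x‖ ^ 2 = 0 := by linarith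
    simpa [(sub_pos.mpr h2).ne'] using this
  conv_lhs => rw [← v.sum_repr' x, Fin.sum_univ_three, q1, q2]
  simp

theorem kthEigenvalue_zero_le {θ : ℝ} {z : ℂ} (hz : ∀ w ∈ numericalRange A,
      (Complex.exp (θ * Complex.I) * w).re ≤ (Complex.exp (θ * Complex.I) * z).re) :
    kthEigenvalue A 0 θ ≤ (Complex.exp (θ * Complex.I) * z).re := by
  obtain ⟨w, hw, h⟩ := exists_mem_re_eq A 0 θ
  exact h ▸ hz w hw

theorem IsGeneric.eigenvector_of_top (hA : IsGeneric A) {θ : ℝ}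
    {x : EuclideanSpace ℂ (Fin 3)} (hx : ‖x‖ = 1)
    (htop : kthEigenvalue A 0 θ ≤
      (Complex.exp (θ * Complex.I) * inner ℂ x (toEuclideanLin A x)).re) :
    toEuclideanLin (rePart (Complex.exp (θ * Complex.I) • A)) x =
      (kthEigenvalue A 0 θ : ℂ) • x := by
  obtain ⟨v, hv⟩ := exists_eigenbasis A θ
  rw [hA.eq_smul_of_top hv hx htop, map_smul, hv, smul_comm]

theorem IsGeneric.eq_of_top (hA : IsGeneric A) {θ : ℝ} {a b : ℂ} (ha : a ∈ numericalRange A)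
    (hb : b ∈ numericalRange A)
    (hta : kthEigenvalue A 0 θ ≤ (Complex.exp (θ * Complex.I) * a).re)
    (htb : kthEigenvalue A 0 θ ≤ (Complex.exp (θ * Complex.I) * b).re) : a = b := by
  obtain ⟨v, hv⟩ := exists_eigenbasis A θ
  have key : ∀ a ∈ numericalRange A,
      kthEigenvalue A 0 θ ≤ (Complex.exp (θ * Complex.I) * a).re →
      a = inner ℂ (v 0) (toEuclideanLin A (v 0)) := by
    rintro _ ⟨x, hx, rfl⟩ h
    have h1 := hA.eq_smul_of_top hv hx h
    set α := inner ℂ (v 0) x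
    have hα : ‖α‖ = 1 := by
      have := congrArg norm h1
      rwa [norm_smul, hx, v.norm_eq_one, mul_one, eq_comm] at this
    rw [h1, map_smul, inner_smul_left, inner_smul_right, ← mul_assoc, Complex.conj_mul', hα]
    simp
  rw [key a ha hta, key b hb htb]

theorem IsGeneric.not_re_const (hA : IsGeneric A) {θ b : ℝ}
    (h : ∀ w ∈ numericalRange A, (Complex.exp (θ * Complex.I) * w).re = b) : False := by
  obtain ⟨w₀, hw₀, h₀⟩ := exists_mem_re_eq A 0 θ
  obtain ⟨w₁, hw₁, h₁⟩ := exists_mem_re_eq A 1 θ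
  rw [h _ hw₀] at h₀
  rw [h _ hw₁] at h₁
  exact absurd (hA θ (h₀.symm.trans h₁)) (by decide)

theorem numericalRange_nonempty : (numericalRange A).Nonempty :=
  let ⟨w, hw, _⟩ := exists_mem_re_eq A 0 0
  ⟨w, hw⟩

theorem IsGeneric.interior_nonempty (hA : IsGeneric A) : (interior (numericalRange A)).Nonempty := by
  by_contra h
  obtain ⟨θ, b, hb⟩ := exists_angle_re_const (convex_numericalRange A) numericalRange_nonempty h
  exact hA.not_re_const hb

theorem IsGeneric.strictConvex (hA : IsGeneric A) : StrictConvex ℝ (numericalRange A) := by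
  intro x hx y hy hne a b ha hb hab
  by_contra hz
  -- A supporting line through a point strictly between `x` and `y` contains both of them.
  obtain ⟨θ, hθ⟩ := exists_angle_forall_le (convex_numericalRange A) hA.interior_nonempty hz
  set e := Complex.exp (θ * Complex.I)
  have hlin : (e * (a • x + b • y)).re = a * (e * x).re + b * (e * y).re := by
    rw [mul_add, mul_smul_comm, mul_smul_comm, Complex.add_re, Complex.smul_re, Complex.smul_re]
    rfl
  have h0 := kthEigenvalue_zero_le hθ
  have hx1 := re_le_of_mem A (fun k => kthEigenvalue_le_zero k θ) hx
  have hy1 := re_le_of_mem A (fun k => kthEigenvalue_le_zero k θ) hy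
  change (e * x).re ≤ _ at hx1
  change (e * y).re ≤ _ at hy1
  rw [hlin] at h0
  obtain rfl : b = 1 - a := by linarith
  refine hne (hA.eq_of_top (θ := θ) hx hy ?_ ?_)
  · change _ ≤ (e * x).re
    nlinarith
  · change _ ≤ (e * y).re
    nlinarith

/-- If `A` is generic, a unit vector whose value lies on a supporting line is not a common
eigenvector of `A` and its adjoint. -/
theorem IsGeneric.not_common_eigenvector (hA : IsGeneric A) {x : EuclideanSpace ℂ (Fin 3)}
    (hx : ‖x‖ = 1) {α β : ℂ} (hT : toEuclideanLin A x = α • x)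
    (hT' : (toEuclideanLin A).adjoint x = β • x) {θ : ℝ}
    (hz : ∀ w ∈ numericalRange A, (Complex.exp (θ * Complex.I) * w).re ≤
      (Complex.exp (θ * Complex.I) * inner ℂ x (toEuclideanLin A x)).re) : False := by
  have hxx : inner ℂ x x = (1 : ℂ) := by rw [inner_self_eq_norm_sq_to_K, hx]; simp
  have hα : inner ℂ x (toEuclideanLin A x) = α := by rw [hT, inner_smul_right, hxx, mul_one]
  have hβ : β = conj α := by
    have := LinearMap.adjoint_inner_right (toEuclideanLin A) x x
    rwa [hT', inner_smul_right, hxx, mul_one, hT, inner_smul_left, hxx, mul_one] at this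
  rw [hα] at hz
  have hαW : α ∈ numericalRange A := ⟨x, hx, hα⟩
  -- A half turn exchanges maximum and minimum, so `α` realizes `λ₁` at `θ` and `λ₃` at `θ + π`.
  have hneg : ∀ w : ℂ, (Complex.exp ((θ + Real.pi : ℝ) * Complex.I) * w).re =
      -(Complex.exp (θ * Complex.I) * w).re := by
    intro w
    rw [Complex.ofReal_add, add_mul, Complex.exp_add, Complex.exp_pi_mul_I]
    simp
  refine hA.not_reducing (θ₁ := θ) (by rintro rfl; simp at hx) hT (hβ ▸ hT') ?_ ?_
  · exact le_antisymm (re_le_of_mem A (fun k => kthEigenvalue_le_zero k θ) hαW)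
      (kthEigenvalue_zero_le hz)
  · refine le_antisymm (le_re_of_mem A (fun k => kthEigenvalue_two_le k _) hαW) ?_
    obtain ⟨w, hw, h⟩ := exists_mem_re_eq A 2 (θ + Real.pi)
    rw [← h, hneg, hneg]
    exact neg_le_neg (hz w hw)

theorem IsGeneric.no_corner (hA : IsGeneric A) {z : ℂ} (hz : z ∈ frontier (numericalRange A)) :
    ∃! u : ℂ, IsSupportNormal (numericalRange A) z u := by
  have hzW : z ∈ numericalRange A := (isCompact_numericalRange A).isClosed.frontier_subset hz
  obtain ⟨θ, hθ⟩ := exists_angle_forall_le (convex_numericalRange A) hA.interior_nonempty hz.2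
  have hex : IsSupportNormal (numericalRange A) z (conj (Complex.exp (θ * Complex.I))) :=
    ⟨by rw [Complex.norm_conj, norm_exp_angle], by simpa only [Complex.conj_conj] using hθ⟩
  refine existsUnique_of_exists_of_unique ⟨_, hex⟩ ?_
  rintro u₁ u₂ ⟨hu₁, h₁⟩ ⟨hu₂, h₂⟩
  obtain ⟨θ₁, e₁⟩ := exists_angle_of_unit (c := conj u₁) (by rwa [Complex.norm_conj])
  obtain ⟨θ₂, e₂⟩ := exists_angle_of_unit (c := conj u₂) (by rwa [Complex.norm_conj])
  rw [← e₁] at h₁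
  rw [← e₂] at h₂
  obtain ⟨x, hx, rfl⟩ := hzW
  have s₁ := hA.eigenvector_of_top hx (kthEigenvalue_zero_le h₁)
  have s₂ := hA.eigenvector_of_top hx (kthEigenvalue_zero_le h₂)
  rw [toEuclideanLin_rePart_apply, e₁, Complex.conj_conj] at s₁
  rw [toEuclideanLin_rePart_apply, e₂, Complex.conj_conj] at s₂
  by_contra hne
  have hc₁ : conj u₁ * u₁ = 1 := by rw [Complex.conj_mul', hu₁]; simp
  have hc₂ : conj u₂ * u₂ = 1 := by rw [Complex.conj_mul', hu₂]; simp
  -- Determinant of the system for `Ax`, `A*x`. It vanishes only for `u₂ = ±u₁`; opposite normals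
  -- would squeeze `W(A)` into a line, and otherwise Cramer's rule applies.
  by_cases hd : conj u₁ * u₂ - conj u₂ * u₁ = 0
  · have hsq : (u₂ - u₁) * (u₂ + u₁) = 0 := by
      linear_combination u₁ * u₂ * hd - u₂ ^ 2 * hc₁ + u₁ ^ 2 * hc₂
    have hopp : u₂ = -u₁ := by
      rcases mul_eq_zero.mp hsq with h | h
      · exact absurd (sub_eq_zero.mp h).symm hne
      · exact eq_neg_of_add_eq_zero_left h
    refine hA.not_re_const (θ := θ₁) fun w hw => le_antisymm (h₁ w hw) ?_
    have := h₂ w hw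
    rw [e₂, hopp, map_neg, ← e₁, neg_mul, neg_mul, Complex.neg_re, Complex.neg_re] at this
    exact neg_le_neg_iff.mp this
  · set T := toEuclideanLin A
    set D := conj u₁ * u₂ - conj u₂ * u₁ with hD
    set l₁ : ℂ := (kthEigenvalue A 0 θ₁ : ℂ)
    set l₂ : ℂ := (kthEigenvalue A 0 θ₂ : ℂ)
    have hT : T x = (D⁻¹ * (2 * (u₂ * l₁ - u₁ * l₂))) • x := by
      rw [mul_smul, eq_inv_smul_iff₀ hd]
      have : (2 * (u₂ * l₁ - u₁ * l₂)) • x = (2 * u₂) • (l₁ • x) - (2 * u₁) • (l₂ • x) := by module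
      rw [this, ← s₁, ← s₂, hD]
      module
    have hT' : T.adjoint x = (D⁻¹ * (2 * (conj u₁ * l₂ - conj u₂ * l₁))) • x := by
      rw [mul_smul, eq_inv_smul_iff₀ hd]
      have : (2 * (conj u₁ * l₂ - conj u₂ * l₁)) • x =
        (2 * conj u₁) • (l₂ • x) - (2 * conj u₂) • (l₁ • x) := by module
      rw [this, ← s₁, ← s₂, hD]
      module
    exact hA.not_common_eigenvector hx hT hT' h₁

theorem IsGeneric.eigenvalue_not_mem_frontier (hA : IsGeneric A) {μ : ℂ}
    (hμ : Module.End.HasEigenvalue (toLin' A) μ) : μ ∉ frontier (numericalRange A) := by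
  intro hz
  obtain ⟨y, hy⟩ := hμ.exists_hasEigenvector
  obtain ⟨hy1, hy0⟩ := Module.End.hasEigenvector_iff.mp hy
  rw [Module.End.mem_eigenspace_iff, toLin'_apply] at hy1
  have hY : WithLp.toLp 2 y ≠ 0 := by simpa using hy0
  have hYn : (‖WithLp.toLp 2 y‖ : ℂ) ≠ 0 := by simpa using hY
  set x : EuclideanSpace ℂ (Fin 3) := (‖WithLp.toLp 2 y‖⁻¹ : ℂ) • WithLp.toLp 2 y with hxdef
  have hx : ‖x‖ = 1 := by
    rw [hxdef, norm_smul, norm_inv, Complex.norm_real, norm_norm,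
      inv_mul_cancel₀ (by exact_mod_cast hYn)]
  have hT : toEuclideanLin A x = μ • x := by
    rw [hxdef, map_smul, toLpLin_toLp, toLin'_apply, hy1, WithLp.toLp_smul, smul_comm]
  have hxx : inner ℂ x x = (1 : ℂ) := by rw [inner_self_eq_norm_sq_to_K, hx]; simp
  have hμx : inner ℂ x (toEuclideanLin A x) = μ := by rw [hT, inner_smul_right, hxx, mul_one]
  obtain ⟨θ, hθ⟩ := exists_angle_forall_le (convex_numericalRange A) hA.interior_nonempty hz.2
  rw [← hμx] at hθ
  have s := hA.eigenvector_of_top hx (kthEigenvalue_zero_le hθ)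
  rw [toEuclideanLin_rePart_apply, hT] at s
  set c := Complex.exp (θ * Complex.I) with hc
  have hcc : c * conj c = 1 := by rw [mul_comm, Complex.conj_mul', hc, norm_exp_angle]; simp
  set l : ℂ := (kthEigenvalue A 0 θ : ℂ)
  -- `β` solves `(cμ + c̄β) / 2 = l`, using `c̄⁻¹ = c`.
  refine hA.not_common_eigenvector hx hT (β := c * (2 * l - c * μ)) ?_ hθ
  have : (c * (2 * l - c * μ)) • x = (2 * c) • (l • x) - (c * c * μ) • x := by module
  rw [this, ← s]
  have h2 : (toEuclideanLin A).adjoint x = (c * conj c) • (toEuclideanLin A).adjoint x := by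
    rw [hcc, one_smul]
  conv_lhs => rw [h2]
  module

/-! ### Strict convexity and ellipses in the plane -/

section Plane

theorem not_mem_interior_of_forall_re_le {K : Set ℂ} {e z : ℂ} (he : e ≠ 0)
    (h : ∀ w ∈ K, (e * w).re ≤ (e * z).re) : z ∉ interior K := by
  intro hz
  -- `conj e` is the direction in which `Re (e ·)` increases.
  have hcont : Continuous fun t : ℝ => z + t * conj e := by fun_prop
  have hmem : ∀ᶠ t : ℝ in nhds 0, z + t * conj e ∈ interior K :=
    hcont.continuousAt.eventually_mem (isOpen_interior.mem_nhds (by simpa using hz))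
  obtain ⟨ε, hε, hball⟩ := Metric.eventually_nhds_iff.mp hmem
  have h1 := h _ (interior_subset (hball (y := ε / 2) (by
    rw [Real.dist_eq, sub_zero, abs_of_pos (half_pos hε)]; exact half_lt_self hε)))
  have h2 : e * (z + (ε / 2 : ℝ) * conj e) = e * z + ((ε / 2 * ‖e‖ ^ 2 : ℝ) : ℂ) := by
    push_cast
    rw [← Complex.mul_conj']
    ring
  rw [h2, Complex.add_re, Complex.ofReal_re] at h1
  have : 0 < ε / 2 * ‖e‖ ^ 2 := by positivity
  linarith

theorem eq_of_re_eq_of_strictConvex {K : Set ℂ} (hK : StrictConvex ℝ K) {e x y : ℂ} (he : e ≠ 0)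
    {b : ℝ} (h : ∀ w ∈ K, (e * w).re ≤ b) (hx : x ∈ K) (hy : y ∈ K) (hxb : (e * x).re = b)
    (hyb : (e * y).re = b) : x = y := by
  by_contra hne
  have hmid := hK hx hy hne (a := 1 / 2) (b := 1 / 2) (by norm_num) (by norm_num) (by norm_num)
  refine not_mem_interior_of_forall_re_le he (fun w hw => ?_) hmid
  rw [mul_add, mul_smul_comm, mul_smul_comm, Complex.add_re, Complex.smul_re, Complex.smul_re,
    hxb, hyb]
  refine (h w hw).trans_eq ?_
  simp only [smul_eq_mul]
  ring

theorem IsEllipse.strictConvex {K : Set ℂ} (hK : IsEllipse K) : StrictConvex ℝ K := by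
  obtain ⟨f, rfl⟩ := hK
  have hf : IsOpenMap f := (AffineEquiv.toContinuousAffineEquiv f).toHomeomorph.isOpenMap
  exact (strictConvex_closedBall ℝ (0 : ℂ) 1).affine_image (f := (f : ℂ →ᵃ[ℝ] ℂ)) hf

theorem IsEllipse.interior_nonempty {K : Set ℂ} (hK : IsEllipse K) : (interior K).Nonempty := by
  obtain ⟨f, rfl⟩ := hK
  have hf : IsOpenMap f := (AffineEquiv.toContinuousAffineEquiv f).toHomeomorph.isOpenMap
  refine ⟨f 0, hf.image_interior_subset _ ⟨0, ?_, rfl⟩⟩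
  rw [interior_closedBall _ one_ne_zero]
  simp

/-- The real affine image of the disk under `X + iY ↦ z + c⁻¹(inX + cw(1 + Y)/2)`. -/
theorem isEllipse_of_param {c w z : ℂ} {n : ℝ} (hc : ‖c‖ = 1) (hn : n ≠ 0) (hw : (c * w).re ≠ 0)
    {K : Set ℂ} (hK : ∀ y, y ∈ K ↔ ∃ ζ : ℂ, ‖ζ‖ ≤ 1 ∧
      y = z + (conj c * (Complex.I * n * ζ.re) + w * ((1 + ζ.im) / 2 : ℝ))) : IsEllipse K := by
  let L : ℂ →ₗ[ℝ] ℂ := Complex.reLm.smulRight (conj c * (Complex.I * n)) +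
    Complex.imLm.smulRight (w / 2)
  have hL : ∀ ζ, L ζ = ζ.re * (conj c * (Complex.I * n)) + ζ.im * (w / 2) := by
    intro ζ; simp [L]
  have hcc : c * conj c = 1 := by rw [Complex.mul_conj', hc]; simp
  have hinj : Function.Injective L := by
    rw [injective_iff_map_eq_zero]
    intro ζ hζ
    rw [hL] at hζ
    have h1 : (ζ.re * n : ℝ) * Complex.I + (ζ.im / 2 : ℝ) * (c * w) = 0 := by
      push_cast
      linear_combination c * hζ - ζ.re * Complex.I * n * hcc
    have h2 := congrArg Complex.re h1
    have h3 := congrArg Complex.im h1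
    simp only [Complex.add_re, Complex.re_ofReal_mul, Complex.I_re, mul_zero, zero_add,
      Complex.zero_re, Complex.add_im, Complex.im_ofReal_mul, Complex.I_im, mul_one,
      Complex.zero_im] at h2 h3
    have him : ζ.im = 0 := by
      rcases mul_eq_zero.mp h2 with h | h
      · linarith
      · exact absurd h hw
    have hre : ζ.re = 0 := by
      rw [him] at h3
      simpa [hn] using h3
    exact Complex.ext hre him
  refine ⟨(LinearEquiv.ofInjectiveEndo L hinj).toAffineEquiv.trans
    (AffineEquiv.constVAdd ℝ ℂ (z + w / 2)), ?_⟩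
  ext y
  rw [hK]
  simp only [Set.mem_image, mem_closedBall_zero_iff]
  refine exists_congr fun ζ => and_congr_right fun _ => ?_
  have : ((LinearEquiv.ofInjectiveEndo L hinj).toAffineEquiv.trans
    (AffineEquiv.constVAdd ℝ ℂ (z + w / 2))) ζ = z + w / 2 + L ζ := rfl
  rw [this, hL, eq_comm]
  refine Eq.congr_left ?_
  push_cast
  ring

end Plane

/-! ### The converse: a double extreme eigenvalue -/

/-- The values `κ` takes in `2i·Im κ + cw·|r|²`, parametrized by the disk. -/
theorem exists_disk_param {α₀ α₁ c p q r : ℂ} (hc : ‖c‖ = 1) {n : ℝ} (hn : 0 < n)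
    (hα : ‖α₀‖ ^ 2 + ‖α₁‖ ^ 2 = n ^ 2) (hx : ‖p‖ ^ 2 + ‖q‖ ^ 2 + ‖r‖ ^ 2 = 1) :
    ∃ ζ : ℂ, ‖ζ‖ ≤ 1 ∧ 2 * (c * conj r * (p * α₀ + q * α₁)).im = n * ζ.re ∧
      ‖r‖ ^ 2 = (1 + ζ.im) / 2 := by
  set m := p * α₀ + q * α₁ with hm
  have hCS : ‖m‖ ≤ ‖p‖ * ‖α₀‖ + ‖q‖ * ‖α₁‖ := by
    refine (norm_add_le _ _).trans_eq ?_
    rw [norm_mul, norm_mul]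
  have hm2 : ‖m‖ ^ 2 ≤ (‖p‖ ^ 2 + ‖q‖ ^ 2) * n ^ 2 := by
    rw [← hα]
    calc ‖m‖ ^ 2 ≤ (‖p‖ * ‖α₀‖ + ‖q‖ * ‖α₁‖) ^ 2 := by gcongr
      _ ≤ _ := by linarith [sq_nonneg (‖p‖ * ‖α₁‖ - ‖q‖ * ‖α₀‖)]
  set s := (c * conj r * m).im with hs
  have hs2 : s ^ 2 ≤ ‖r‖ ^ 2 * ‖m‖ ^ 2 := by
    have h1 : |s| ≤ ‖r‖ * ‖m‖ := by
      refine (Complex.abs_im_le_norm _).trans_eq ?_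
      rw [norm_mul, norm_mul, hc, Complex.norm_conj, one_mul]
    rw [← sq_abs, ← mul_pow]
    gcongr
  -- With `t = |r|²`, Cauchy–Schwarz gives `|ζ|² ≤ 4t(1 - t) + (2t - 1)² = 1`.
  refine ⟨⟨2 * s / n, 2 * ‖r‖ ^ 2 - 1⟩, ?_, ?_, ?_⟩
  · rw [← sq_le_one_iff₀ (norm_nonneg _), Complex.sq_norm, Complex.normSq_mk]
    have h3 : s ^ 2 ≤ ‖r‖ ^ 2 * ((1 - ‖r‖ ^ 2) * n ^ 2) := by
      refine hs2.trans (mul_le_mul_of_nonneg_left (hm2.trans_eq ?_) (sq_nonneg _))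
      rw [← hx]; ring
    have h4 : 2 * s / n * (2 * s / n) = 4 * (s ^ 2 / n ^ 2) := by field_simp; ring
    have h5 : s ^ 2 / n ^ 2 ≤ ‖r‖ ^ 2 * (1 - ‖r‖ ^ 2) := by
      rw [div_le_iff₀ (by positivity)]; linarith
    rw [h4]
    linarith
  · simp only; field_simp
  · simp

/-- Equality in Cauchy–Schwarz: `(p, q)` is taken proportional to `(ᾱ₀, ᾱ₁)`, and its phase `φ` is
tuned to give the prescribed imaginary part. -/
theorem exists_of_disk_param {α₀ α₁ c : ℂ} (hc : ‖c‖ = 1) {n : ℝ} (hn : 0 < n)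
    (hα : ‖α₀‖ ^ 2 + ‖α₁‖ ^ 2 = n ^ 2) {ζ : ℂ} (hζ : ‖ζ‖ ≤ 1) :
    ∃ p q r : ℂ, ‖p‖ ^ 2 + ‖q‖ ^ 2 + ‖r‖ ^ 2 = 1 ∧
      2 * (c * conj r * (p * α₀ + q * α₁)).im = n * ζ.re ∧ ‖r‖ ^ 2 = (1 + ζ.im) / 2 := by
  have hζ2 : ζ.re ^ 2 + ζ.im ^ 2 ≤ 1 := by
    have := (sq_le_one_iff₀ (norm_nonneg _)).mpr hζ
    rw [Complex.sq_norm, Complex.normSq_apply] at this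
    linarith
  have him : |ζ.im| ≤ 1 := (Complex.abs_im_le_norm ζ).trans hζ
  rw [abs_le] at him
  set t := (1 + ζ.im) / 2 with ht
  have ht0 : 0 ≤ t := by linarith
  have ht1 : 0 ≤ 1 - t := by linarith
  set ρ := Real.sqrt t * Real.sqrt (1 - t) with hρ
  have hρ2 : ρ ^ 2 = t * (1 - t) := by rw [hρ, mul_pow, Real.sq_sqrt ht0, Real.sq_sqrt ht1]
  have hρ0 : 0 ≤ ρ := by positivity
  have hX : |ζ.re / 2| ≤ ρ := by
    refine abs_le_of_sq_le_sq ?_ hρ0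
    rw [hρ2, ht]
    linarith
  obtain ⟨φ, hφ⟩ : ∃ φ, ρ * Real.sin φ = ζ.re / 2 := by
    -- When `ρ = 0` the choice is immaterial, since `hX` then forces `ζ.re = 0`.
    refine ⟨Real.arcsin (ζ.re / 2 / ρ), ?_⟩
    rcases hρ0.eq_or_lt with h | h
    · rw [← h] at hX ⊢
      rw [zero_mul]
      exact (abs_nonpos_iff.mp hX).symm
    · have := abs_le.mp hX
      rw [Real.sin_arcsin, mul_div_cancel₀ _ h.ne']
      · rw [le_div_iff₀ h]; linarith
      · rw [div_le_one h]; linarith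
  set g : ℂ := conj c * (Real.sqrt (1 - t) * Complex.exp (φ * Complex.I)) / n with hg
  have hgn : ‖g‖ ^ 2 * n ^ 2 = 1 - t := by
    rw [hg, norm_div, norm_mul, norm_mul, Complex.norm_conj, hc, norm_exp_angle, Complex.norm_real,
      Complex.norm_real, Real.norm_of_nonneg (Real.sqrt_nonneg _), Real.norm_of_nonneg hn.le,
      div_pow, div_mul_cancel₀ _ (by positivity), one_mul, mul_one, Real.sq_sqrt ht1]
  have hcc : c * conj c = 1 := by rw [Complex.mul_conj', hc]; simp
  have hnc : (n : ℂ) ≠ 0 := by exact_mod_cast hn.ne'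
  refine ⟨conj α₀ * g, conj α₁ * g, Real.sqrt t, ?_, ?_, ?_⟩
  · rw [norm_mul, norm_mul, Complex.norm_conj, Complex.norm_conj, mul_pow, mul_pow, ← add_mul, hα,
      mul_comm, hgn, Complex.norm_real, Real.norm_of_nonneg (Real.sqrt_nonneg _), Real.sq_sqrt ht0]
    ring
  · have h1 : conj α₀ * g * α₀ + conj α₁ * g * α₁ = n ^ 2 * g := by
      have : conj α₀ * α₀ + conj α₁ * α₁ = (n : ℂ) ^ 2 := by
        rw [Complex.conj_mul', Complex.conj_mul']
        exact_mod_cast hα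
      rw [← this]; ring
    have h2 : c * conj (Real.sqrt t : ℂ) * (n ^ 2 * g) =
        ((n * ρ : ℝ) : ℂ) * Complex.exp (φ * Complex.I) := by
      rw [Complex.conj_ofReal, hg, hρ]
      push_cast
      rw [mul_div_assoc', mul_div_assoc', div_eq_iff hnc]
      linear_combination (n ^ 2 * Real.sqrt t * Real.sqrt (1 - t) *
        Complex.exp (φ * Complex.I)) * hcc
    rw [h1, h2, Complex.im_ofReal_mul, Complex.exp_ofReal_mul_I_im]
    linear_combination 2 * n * hφ
  · rw [Complex.norm_real, Real.norm_of_nonneg (Real.sqrt_nonneg _), Real.sq_sqrt ht0]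

/-- If the largest eigenvalue of `Re (cA)` is double and `W(A)` is strictly convex with interior
points, then `W(A)` is an ellipse with an eigenvalue of `A` on its boundary. -/
theorem isEllipse_of_double_eigenvalue {A : Matrix (Fin 3) (Fin 3) ℂ}
    (hsc : StrictConvex ℝ (numericalRange A)) (hi : (interior (numericalRange A)).Nonempty)
    {c : ℂ} (hc : ‖c‖ = 1) (v : OrthonormalBasis (Fin 3) ℂ (EuclideanSpace ℂ (Fin 3)))
    (l : Fin 3 → ℝ) (hv : ∀ k, toEuclideanLin (rePart (c • A)) (v k) = (l k : ℂ) • v k)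
    (h01 : l 1 = l 0) (h2 : l 2 ≤ l 0) :
    IsEllipse (numericalRange A) ∧ ∃ μ : ℂ, Module.End.HasEigenvalue (toLin' A) μ ∧
      μ ∈ frontier (numericalRange A) := by
  have hc0 : c ≠ 0 := by rintro rfl; simp at hc
  have hcc : c * conj c = 1 := by rw [Complex.mul_conj', hc]; simp
  set T := toEuclideanLin A with hT
  have hform : ∀ x : EuclideanSpace ℂ (Fin 3), ‖x‖ = 1 →
      (c * inner ℂ x (T x)).re = l 0 - (l 0 - l 2) * ‖inner ℂ (v 2) x‖ ^ 2 := by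
    intro x hx
    have hn := sum_sq_norm_inner_eq_one v hx
    rw [Fin.sum_univ_three] at hn
    rw [re_mul_inner_eq_sum A c v l hv, Fin.sum_univ_three, h01]
    linear_combination l 0 * hn
  have hle : ∀ w ∈ numericalRange A, (c * w).re ≤ l 0 := by
    rintro _ ⟨x, hx, rfl⟩
    rw [hform x hx]
    have := mul_nonneg (sub_nonneg.mpr h2) (sq_nonneg ‖inner ℂ (v 2) x‖)
    linarith
  have hlt : l 2 < l 0 := by
    refine lt_of_le_of_ne h2 fun h => ?_
    obtain ⟨y, hy⟩ := hi
    refine not_mem_interior_of_forall_re_le hc0 (fun w hw => ?_) hy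
    obtain ⟨x, hx, hxy⟩ := interior_subset hy
    rw [← hxy]
    change _ ≤ (c * inner ℂ x (T x)).re
    rw [hform x hx, h, sub_self, zero_mul, sub_zero]
    exact hle w hw
  have hvv : ∀ i j, inner ℂ (v i) (v j) = if i = j then (1 : ℂ) else 0 :=
    fun i j => orthonormal_iff_ite.mp v.orthonormal i j
  set z := inner ℂ (v 0) (T (v 0)) with hz
  have hzW : z ∈ numericalRange A := ⟨v 0, v.norm_eq_one 0, rfl⟩
  have hcz : (c * z).re = l 0 := by
    rw [hz, hform _ (v.norm_eq_one 0), hvv]; simp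
  -- Unit vectors orthogonal to `v 2` have their values on one supporting line, which strict
  -- convexity reduces to the point `z`.
  have htop : ∀ x : EuclideanSpace ℂ (Fin 3), inner ℂ (v 2) x = 0 →
      inner ℂ x (T x) = z * ‖x‖ ^ 2 := by
    intro x hx
    by_cases hx0 : x = 0
    · simp [hx0]
    have hxn : (‖x‖ : ℂ) ≠ 0 := by simpa using hx0
    have hu : ‖(‖x‖⁻¹ : ℂ) • x‖ = 1 := by
      rw [norm_smul, norm_inv, Complex.norm_real, norm_norm,
        inv_mul_cancel₀ (norm_ne_zero_iff.mpr hx0)]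
    have h1 : inner ℂ ((‖x‖⁻¹ : ℂ) • x) (T ((‖x‖⁻¹ : ℂ) • x)) = z := by
      refine eq_of_re_eq_of_strictConvex hsc hc0 hle ⟨_, hu, rfl⟩ hzW ?_ hcz
      rw [hform _ hu, inner_smul_right, hx]
      simp
    rw [map_smul, inner_smul_left, inner_smul_right, map_inv₀, Complex.conj_ofReal] at h1
    rw [← h1]
    field_simp
  -- polarization on the span of `v 0` and `v 1`
  have e0 : inner ℂ (v 0) (T (v 0)) = z := rfl
  have e1 : inner ℂ (v 1) (T (v 1)) = z := by
    rw [htop _ (by rw [hvv]; simp), v.norm_eq_one]; simp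
  have hpol : ∀ d : ℂ, ‖d‖ = 1 →
      d * inner ℂ (v 0) (T (v 1)) + conj d * inner ℂ (v 1) (T (v 0)) = 0 := by
    intro d hd
    have hdd : conj d * d = 1 := by rw [Complex.conj_mul', hd]; simp
    have h1 := htop (v 0 + d • v 1) (by rw [inner_add_right, inner_smul_right, hvv, hvv]; simp)
    have h3 : ((‖v 0 + d • v 1‖ : ℂ)) ^ 2 = 2 := by
      have := inner_self_eq_norm_sq_to_K (𝕜 := ℂ) (v 0 + d • v 1)
      rw [inner_add_left, inner_add_right, inner_add_right, inner_smul_left, inner_smul_left,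
        inner_smul_right, inner_smul_right, hvv, hvv, hvv, hvv] at this
      simp only [if_true, zero_ne_one, one_ne_zero, if_false] at this
      refine this.symm.trans ?_
      linear_combination hdd
    rw [h3, map_add, map_smul, inner_add_left, inner_add_right, inner_add_right, inner_smul_left,
      inner_smul_left, inner_smul_right, inner_smul_right, e0, e1] at h1
    linear_combination h1 - z * hdd
  have hp1 := hpol 1 (by simp)
  have hpI := hpol Complex.I (by simp)
  rw [RingHom.map_one] at hp1
  rw [Complex.conj_I] at hpI
  have t01 : inner ℂ (v 0) (T (v 1)) = 0 := by
    linear_combination (1 / 2 : ℂ) * hp1 - (1 / 2 * Complex.I) * hpI +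
      (1 / 2) * (inner ℂ (v 0) (T (v 1)) - inner ℂ (v 1) (T (v 0))) * Complex.I_sq
  have t10 : inner ℂ (v 1) (T (v 0)) = 0 := by
    linear_combination hp1 - t01
  set α₀ := inner ℂ (v 2) (T (v 0)) with hα₀
  set α₁ := inner ℂ (v 2) (T (v 1)) with hα₁
  have T0 : T (v 0) = z • v 0 + α₀ • v 2 := by
    conv_lhs => rw [← v.sum_repr' (T (v 0)), Fin.sum_univ_three, e0, t10]
    rw [zero_smul, add_zero]
  have T1 : T (v 1) = z • v 1 + α₁ • v 2 := by
    conv_lhs => rw [← v.sum_repr' (T (v 1)), Fin.sum_univ_three, e1, t01]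
    rw [zero_smul, zero_add]
  -- `Re (cA)` is diagonal in the basis `v`, which ties row entries of `A` to column entries.
  have hoff : ∀ j, j ≠ 2 →
      inner ℂ (v j) (T (v 2)) = -(conj c) ^ 2 * conj (inner ℂ (v 2) (T (v j))) := by
    intro j hj
    have h1 : inner ℂ (v j) (toEuclideanLin (rePart (c • A)) (v 2)) = 0 := by
      rw [hv, inner_smul_right, hvv, if_neg hj, mul_zero]
    rw [toEuclideanLin_rePart_apply, inner_smul_right, inner_add_right, inner_smul_right,
      inner_smul_right, LinearMap.adjoint_inner_right] at h1
    rw [inner_conj_symm]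
    linear_combination 2 * conj c * h1 - inner ℂ (v j) (T (v 2)) * hcc
  have b0 := hoff 0 (by decide)
  have b1 := hoff 1 (by decide)
  rw [← hα₀] at b0
  rw [← hα₁] at b1
  set w := inner ℂ (v 2) (T (v 2)) - z with hw
  have e2 : inner ℂ (v 2) (T (v 2)) = z + w := by rw [hw]; ring
  have hcw : (c * w).re < 0 := by
    rw [hw, mul_sub, Complex.sub_re, hcz, re_mul_inner_eigenvector A c (v.norm_eq_one 2) (hv 2)]
    exact sub_neg.mpr hlt
  -- With `κ = c r̄ (pα₀ + qα₁)`, `hoff` turns the cross terms into `c̄(κ - κ̄)`.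
  have hquad : ∀ p q r : ℂ, inner ℂ (p • v 0 + q • v 1 + r • v 2) (T (p • v 0 + q • v 1 + r • v 2)) =
      z * (‖p‖ ^ 2 + ‖q‖ ^ 2 + ‖r‖ ^ 2 : ℝ) + (conj c * (Complex.I *
        (2 * (c * conj r * (p * α₀ + q * α₁)).im : ℝ)) + w * (‖r‖ ^ 2 : ℝ)) := by
    intro p q r
    rw [mul_comm Complex.I, ← Complex.sub_conj]
    push_cast
    simp only [← Complex.conj_mul', map_add, map_smul, inner_add_left, inner_add_right,
      inner_smul_left, inner_smul_right, e0, e1, e2, t01, t10, b0, b1, ← hα₀, ← hα₁, map_mul,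
      Complex.conj_conj]
    linear_combination (-(conj r * (p * α₀ + q * α₁))) * hcc
  have hnorm : ∀ p q r : ℂ, ‖p • v 0 + q • v 1 + r • v 2‖ ^ 2 = ‖p‖ ^ 2 + ‖q‖ ^ 2 + ‖r‖ ^ 2 := by
    intro p q r
    rw [← v.sum_sq_norm_inner_right, Fin.sum_univ_three]
    simp [inner_add_right, inner_smul_right, hvv]
  have hmem : ∀ y, y ∈ numericalRange A ↔ ∃ p q r : ℂ, ‖p‖ ^ 2 + ‖q‖ ^ 2 + ‖r‖ ^ 2 = 1 ∧
      y = z + (conj c * (Complex.I *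
        (2 * (c * conj r * (p * α₀ + q * α₁)).im : ℝ)) + w * (‖r‖ ^ 2 : ℝ)) := by
    intro y
    constructor
    · rintro ⟨x, hx, rfl⟩
      have hn := sum_sq_norm_inner_eq_one v hx
      rw [Fin.sum_univ_three] at hn
      refine ⟨_, _, _, hn, ?_⟩
      have hx' : x = inner ℂ (v 0) x • v 0 + inner ℂ (v 1) x • v 1 + inner ℂ (v 2) x • v 2 := by
        conv_lhs => rw [← v.sum_repr' x, Fin.sum_univ_three]
      conv_lhs => rw [hx']
      change inner ℂ _ (T _) = _
      rw [hquad, hn]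
      simp
    · rintro ⟨p, q, r, hn, rfl⟩
      refine ⟨p • v 0 + q • v 1 + r • v 2, ?_, ?_⟩
      · rw [← sq_eq_sq₀ (norm_nonneg _) zero_le_one, hnorm, hn, one_pow]
      · change inner ℂ _ (T _) = _
        rw [hquad, hn]
        simp
  -- Otherwise `W(A)` lies on the line `z + ℝw` and has no interior.
  have hα0 : 0 < ‖α₀‖ ^ 2 + ‖α₁‖ ^ 2 := by
    by_contra hneg
    have h0 : α₀ = 0 := by
      rw [← norm_eq_zero, ← sq_eq_zero_iff]
      linarith [sq_nonneg ‖α₀‖, sq_nonneg ‖α₁‖]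
    have h1 : α₁ = 0 := by
      rw [← norm_eq_zero, ← sq_eq_zero_iff]
      linarith [sq_nonneg ‖α₀‖, sq_nonneg ‖α₁‖]
    have hw0 : w ≠ 0 := by
      rintro h
      rw [h] at hcw
      simp at hcw
    have hline : ∀ y ∈ numericalRange A, (Complex.I * conj w * y).re = (Complex.I * conj w * z).re := by
      intro y hy
      obtain ⟨p, q, r, -, rfl⟩ := (hmem y).mp hy
      have : Complex.I * conj w * (z + (conj c * (Complex.I *
          (2 * (c * conj r * (p * α₀ + q * α₁)).im : ℝ)) + w * (‖r‖ ^ 2 : ℝ))) =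
          Complex.I * conj w * z + ((‖w‖ ^ 2 * ‖r‖ ^ 2 : ℝ) : ℂ) * Complex.I := by
        rw [h0, h1, Complex.ofReal_mul (‖w‖ ^ 2), Complex.ofReal_pow ‖w‖, ← Complex.conj_mul']
        simp only [mul_zero, add_zero, Complex.zero_im, Complex.ofReal_zero, zero_add]
        ring
      rw [this, Complex.add_re, Complex.re_ofReal_mul, Complex.I_re, mul_zero, add_zero]
    obtain ⟨y, hy⟩ := hi
    refine not_mem_interior_of_forall_re_le (e := Complex.I * conj w)
      (mul_ne_zero Complex.I_ne_zero (by simpa using hw0)) (fun u hu => ?_) hy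
    rw [hline u hu, hline y (interior_subset hy)]
  set n := Real.sqrt (‖α₀‖ ^ 2 + ‖α₁‖ ^ 2) with hn
  have hnpos : 0 < n := Real.sqrt_pos.mpr hα0
  have hn2 : ‖α₀‖ ^ 2 + ‖α₁‖ ^ 2 = n ^ 2 := (Real.sq_sqrt hα0.le).symm
  refine ⟨isEllipse_of_param (c := c) (w := w) (z := z) hc hnpos.ne' hcw.ne fun y => ?_, z, ?_, ?_⟩
  · rw [hmem]
    constructor
    · rintro ⟨p, q, r, h, rfl⟩
      obtain ⟨ζ, hζ, h3, h4⟩ := exists_disk_param hc hnpos hn2 h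
      refine ⟨ζ, hζ, ?_⟩
      rw [h3, h4, Complex.ofReal_mul, mul_assoc Complex.I]
    · rintro ⟨ζ, hζ, rfl⟩
      obtain ⟨p, q, r, h, h3, h4⟩ := exists_of_disk_param hc hnpos hn2 hζ
      refine ⟨p, q, r, h, ?_⟩
      rw [h3, h4, Complex.ofReal_mul, mul_assoc Complex.I]
  -- In this combination the `v 2` components of `T (v 0)` and `T (v 1)` cancel.
  · set x := α₁ • v 0 - α₀ • v 1 with hx
    have hTx : T x = z • x := by
      rw [hx, map_sub, map_smul, map_smul, T0, T1]
      module
    have hx0 : x ≠ 0 := by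
      intro h0
      have h3 := hnorm α₁ (-α₀) 0
      rw [zero_smul, add_zero, neg_smul, ← sub_eq_add_neg, ← hx, h0, norm_zero, norm_neg,
        norm_zero] at h3
      linarith
    refine Module.End.hasEigenvalue_of_hasEigenvector (x := WithLp.ofLp x)
      (Module.End.hasEigenvector_iff.mpr ⟨?_, by simpa using hx0⟩)
    rw [Module.End.mem_eigenspace_iff]
    have := congrArg WithLp.ofLp hTx
    simpa [hT] using this
  · exact ⟨subset_closure hzW, not_mem_interior_of_forall_re_le hc0 fun y hy => by
      rw [hcz]; exact hle y hy⟩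

theorem isGeneric_of_strictConvex {A : Matrix (Fin 3) (Fin 3) ℂ}
    (hsc : StrictConvex ℝ (numericalRange A)) (hi : (interior (numericalRange A)).Nonempty)
    (h : IsEllipse (numericalRange A) → ∀ μ : ℂ, Module.End.HasEigenvalue (toLin' A) μ →
      μ ∉ frontier (numericalRange A)) : IsGeneric A := by
  have key : ∀ {c : ℂ} (_ : ‖c‖ = 1) (v : OrthonormalBasis (Fin 3) ℂ (EuclideanSpace ℂ (Fin 3)))
      (l : Fin 3 → ℝ) (_ : ∀ k, toEuclideanLin (rePart (c • A)) (v k) = (l k : ℂ) • v k),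
      l 1 = l 0 → l 2 ≤ l 0 → False := by
    intro c hc v l hv h01 h2
    obtain ⟨he, μ, hμ, hf⟩ := isEllipse_of_double_eigenvalue hsc hi hc v l hv h01 h2
    exact h he μ hμ hf
  intro θ
  obtain ⟨v, hv⟩ := exists_eigenbasis A θ
  have h10 : kthEigenvalue A 1 θ < kthEigenvalue A 0 θ :=
    lt_of_le_of_ne (kthEigenvalue_le_zero 1 θ) fun he =>
      key (norm_exp_angle θ) v _ hv he (kthEigenvalue_le_zero 2 θ)
  have h21 : kthEigenvalue A 2 θ < kthEigenvalue A 1 θ := by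
    refine lt_of_le_of_ne (kthEigenvalue_two_le 1 θ) fun he => ?_
    -- Negating `c` negates the eigenvalues; swapping indices `0` and `2` puts them back in
    -- decreasing order, with the double one on top.
    refine key (c := -Complex.exp (θ * Complex.I)) (by rw [norm_neg, norm_exp_angle])
      (v.reindex (Equiv.swap 0 2)) (fun k => -kthEigenvalue A (Equiv.swap 0 2 k) θ) ?_ ?_ ?_
    · intro k
      rw [OrthonormalBasis.reindex_apply, Equiv.symm_swap]
      have := hv (Equiv.swap 0 2 k)
      rw [toEuclideanLin_rePart_apply] at this ⊢
      rw [Complex.ofReal_neg, neg_smul (kthEigenvalue A _ θ : ℂ), ← this, RingHom.map_neg]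
      module
    · have h1 : (Equiv.swap (0 : Fin 3) 2) 1 = 1 := by decide
      simp only [h1, Equiv.swap_apply_left, he]
    · simp only [Equiv.swap_apply_left, Equiv.swap_apply_right]
      exact neg_le_neg (kthEigenvalue_two_le 0 θ)
  have hanti : StrictAnti fun k : Fin 3 => kthEigenvalue A k θ := by
    rw [Fin.strictAnti_iff_succ_lt]
    intro i
    fin_cases i
    · exact h10
    · exact h21
  exact hanti.injective

end KippenhahnGeneric

open KippenhahnGeneric in
theorem proposition2p2 (A : Matrix (Fin 3) (Fin 3) ℂ) :
    KippenhahnGeneric.IsGeneric A ↔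
      KippenhahnGeneric.IsOvular (KippenhahnGeneric.numericalRange A) ∨
      (KippenhahnGeneric.IsEllipse (KippenhahnGeneric.numericalRange A) ∧
        ∀ μ : ℂ, Module.End.HasEigenvalue (Matrix.toLin' A) μ →
          μ ∉ frontier (KippenhahnGeneric.numericalRange A)) := by
  constructor
  · intro hA
    by_cases he : IsEllipse (numericalRange A)
    · exact Or.inr ⟨he, fun μ hμ => hA.eigenvalue_not_mem_frontier hμ⟩
    · exact Or.inl ⟨isCompact_numericalRange A, hA.interior_nonempty, hA.strictConvex,
        fun z hz => hA.no_corner hz, he⟩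
  · rintro (h | ⟨he, h⟩)
    · exact isGeneric_of_strictConvex h.no_flat_portion h.interior_nonempty
        fun he => absurd he h.not_ellipse
    · exact isGeneric_of_strictConvex he.strictConvex he.interior_nonempty fun _ => h
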